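/- **Setting.** Graphs are finite, simple and undirected, with at least one node; $v(G)$ is the number of nodes of $G$. An *admissible pair* $(G,d)$ consists of a graph $G$ and a real number $d\ge 1$ such that all degrees in $G$ are at most $d$; an *admissible sequence* is a sequence of admissible pairs. For a tree $F$, the homomorphism density is $$t(F,G,d)=\frac{\hom(F,G)}{v(G)\,d^{\,v(F)-1}},$$ where $\hom(F,G)$ is the number of graph homomorphisms from $F$ to $G$. A *sub-Markov kernel* on a measurable space $(X,\mathcal B)$ is a map $(x,A)\mapsto \deg_A(x)\in[0,1]$ ($x\in X$, $A\in\mathcal B$) that is measurable in $x$ for every $A$ and such that $\deg(x):A\mapsto\deg_A(x)$ is a measure for every $x$. Its iterates are given by letting $\deg^0(x)$ be the Dirac measure at $x$ and $\deg^{k+1}_A(x)=\int_X\deg_A\,\mathrm d\deg^k(x)$. Let $\lambda$ be a probability measure on $(X,\mathcal B)$. The kernel is *reversible* if $\int_A\deg_B\,\mathrm d\lambda=\int_B\deg_A\,\mathrm d\lambda$ for all $A,B\in\mathcal B$, and *acyclic* if for $\lambda$-a.e. $x\in X$ the measures $\deg^k(x)$ and $\deg(x)$ are mutually singular for all integers $k\ge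 0$, $k\ne 1$. For $\mathbf G=(X,\mathcal B,\lambda,\deg)$ with $\deg$ a reversible sub-Markov kernel and a tree $F$ with $m+1$ nodes, label the nodes by $0,1,\dots,m$ in such a way that every node with label $i\ge 1$ has a (necessarily unique) neighbour with a label $j(i)<i$, and put $$t(F,\mathbf G)=\int_X\int_X\cdots\int_X \mathrm d\deg(x_{j(m)})(x_m)\cdots \mathrm d\deg(x_{j(1)})(x_1)\,\mathrm d\lambda(x_0);$$ this does not depend on the labelling. **Theorem.** Let $(G_n,d_n)$ be an admissible sequence such that $t(F,G_n,d_n)$ converges as $n\to\infty$ for every tree $F$. Then there exists a probability space endowed with an acyclic reversible sub-Markov kernel, $\mathbf G=(X,\mathcal B,\lambda,\deg)$, such that $t(F,G_n,d_n)\to t(F,\mathbf G)$ for every tree $F$ as $n\to\infty$. -/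

import Mathlib

open MeasureTheory ProbabilityTheory Filter Topology
open scoped ENNReal

namespace GraphLimit

section Graphs

/-- `(G, d)` is an admissible pair: `d ≥ 1` is a real number and all degrees of the finite
graph `G` are at most `d`. -/
def IsAdmissiblePair {V : Type*} (G : SimpleGraph V) (d : ℝ) : Prop :=
  1 ≤ d ∧ ∀ v, (Nat.card (G.neighborSet v) : ℝ) ≤ d

/-- The homomorphism density `t(F, G, d) = hom(F, G) / (v(G) * d ^ (v(F) - 1))` of a connected
finite graph `F` in a finite nonempty graph `G` with all degrees at most `d`. -/
noncomputable def homDensity {U V : Type*} (F : SimpleGraph U) (G : SimpleGraph V) (d : ℝ) : ℝ :=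
  (Nat.card (F →g G) : ℝ) / ((Nat.card V : ℝ) * d ^ (Nat.card U - 1))

/-- An admissible labelling of a finite graph `F`: its nodes are listed as
`node 0, node 1, …` in such a way that every node other than `node 0` has a neighbour with a
smaller label (equivalently, every nonempty initial segment of the list spans a connected
subgraph), together with a choice of such a neighbour, the `parent`. If `F` is a tree, the parent
of every node other than `node 0` is uniquely determined by the labelling, and the edges joining
the nodes to their parents are all the edges of `F`. The node labelled `0` is the root. -/
structure AdmissibleLabeling {U : Type*} (F : SimpleGraph U) where
  node : Fin (Nat.card U) ≃ U
  parent : U → U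
  parent_adj : ∀ i, 0 < i.val → F.Adj (parent (node i)) (node i)
  parent_lt : ∀ i, 0 < i.val → node.symm (parent (node i)) < i

/-- Every connected finite graph has an admissible labelling with any prescribed root. -/
theorem AdmissibleLabeling.exists_root {U : Type*} [Finite U] (F : SimpleGraph U)
    (hF : F.Connected) (o : U) :
    ∃ L : AdmissibleLabeling F, ∀ i, i.val = 0 → L.node i = o := by
  classical
  have key : ∀ v, v ≠ o → ∃ w, F.Adj w v ∧ F.dist o w < F.dist o v := by
    intro v hv
    obtain ⟨p, hp⟩ := hF.exists_walk_length_eq_dist v o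
    cases p with
    | nil => exact absurd rfl hv
    | cons h q =>
      refine ⟨_, h.symm, ?_⟩
      have h1 := SimpleGraph.dist_le q
      rw [SimpleGraph.Walk.length_cons, SimpleGraph.dist_comm] at hp
      rw [SimpleGraph.dist_comm] at h1
      omega
  choose! par hpar using key
  let e : Fin (Nat.card U) ≃ U := (Finite.equivFin U).symm
  let σ := Tuple.sort (fun i => F.dist o (e i))
  have hmono : Monotone (fun i => F.dist o (e (σ i))) :=
    Tuple.monotone_sort (fun i => F.dist o (e i))
  have hroot : ∀ i : Fin (Nat.card U), i.val = 0 → e (σ i) = o := by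
    intro i hi
    have h1 := hmono (show i ≤ σ.symm (e.symm o) from Fin.le_def.2 (by omega))
    simp only [Equiv.apply_symm_apply, SimpleGraph.dist_self, Nat.le_zero] at h1
    exact ((hF.dist_eq_zero_iff).1 h1).symm
  have hne : ∀ i : Fin (Nat.card U), 0 < i.val → e (σ i) ≠ o := by
    intro i hi h
    have h2 : e (σ ⟨0, by omega⟩) = e (σ i) := by rw [h]; exact hroot _ rfl
    have h3 := σ.injective (e.injective h2)
    rw [← h3] at hi
    exact absurd hi (lt_irrefl _)
  refine ⟨⟨σ.trans e, par, fun i hi => (hpar _ (hne i hi)).1, fun i hi => ?_⟩, hroot⟩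
  by_contra hlt
  have h1 := hmono (not_lt.1 hlt)
  have h2 := (hpar _ (hne i hi)).2
  simp only [Equiv.symm_trans_apply, Equiv.apply_symm_apply, Equiv.trans_apply] at h1
  exact absurd h2 (not_lt.2 h1)

end Graphs

section Kernels

variable {X : Type*} [MeasurableSpace X]

/-- A sub-Markov kernel `deg` on `X`: `deg x` is a measure of total mass at most `1` for all `x`
(and `x ↦ deg x A` is measurable for all measurable `A`, as for every `Kernel`). -/
def IsSubMarkov (deg : Kernel X X) : Prop :=
  ∀ x, deg x Set.univ ≤ 1

/-- The iterates of a kernel: `deg⁰ x` is the Dirac measure at `x`, and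
`deg^(k+1) x A = ∫ deg y A d(deg^k x)(y)`. -/
noncomputable def iterKernel (deg : Kernel X X) : ℕ → Kernel X X
  | 0 => Kernel.id
  | k + 1 => deg ∘ₖ iterKernel deg k

/-- The kernel `deg` is acyclic with respect to `P`: for `P`-almost every `x`, the measures
`deg^k x` and `deg x` are mutually singular for all `k ≥ 0` with `k ≠ 1`. -/
def IsAcyclicKernel (deg : Kernel X X) (P : Measure X) : Prop :=
  ∀ᵐ x ∂P, ∀ k : ℕ, k ≠ 1 → iterKernel deg k x ⟂ₘ deg x

open Classical in
/-- Iterated integration over the positions of the nodes in a list, from left to right: each node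
`v` is placed at a point `y` distributed according to `deg (x (parent v))`, where `x` records the
positions of the nodes placed so far. The innermost integrand is `1`. -/
noncomputable def iteratedIntegral {U : Type*} (deg : Kernel X X) (parent : U → U) :
    List U → (U → X) → ℝ≥0∞
  | [], _ => 1
  | v :: l, x =>
      ∫⁻ y, iteratedIntegral deg parent l (Function.update x v y) ∂(deg (x (parent v)))

/-- The rooted homomorphism density `t((F, o), (X, x₀))` of a finite tree `F`, rooted at the node
`o = L.node 0`:
`∫ ⋯ ∫ d(deg x_{j(m)})(x_m) ⋯ d(deg x_{j(1)})(x_1)`, where `m + 1` is the number of nodes and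
`j(i)` is the label of the parent of the node with label `i`. -/
noncomputable def rootedTreeDensity {U : Type*} {F : SimpleGraph U} (L : AdmissibleLabeling F)
    (deg : Kernel X X) (x₀ : X) : ℝ≥0∞ :=
  iteratedIntegral deg L.parent (List.ofFn L.node).tail (fun _ => x₀)

/-- The (unrooted) homomorphism density of a finite tree in a probability space `(X, P)` with a
reversible sub-Markov kernel: the expectation of the rooted density at a `P`-random point. -/
noncomputable def treeDensity {U : Type*} {F : SimpleGraph U} (L : AdmissibleLabeling F)
    (deg : Kernel X X) (P : Measure X) : ℝ :=
  (∫⁻ x₀, rootedTreeDensity L deg x₀ ∂P).toReal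

end Kernels

end GraphLimit

/-!
The limit is built from the ultraproduct of the graphs `G n`, whose random walk kernels of weight
`1 / d n` per edge and uniform measures have ultralimits as Loeb measures: by countable saturation
the ultralimit of measures is countably additive. The tree density of a graph is an iterated
integral of its kernel, iterated integrals commute with ultralimits, and for a convergent sequence
the ultralimit is the limit.

Acyclicity is obtained by running an independent random walk in a second coordinate, which does not
affect the tree densities. This walk takes place on the compact group `(ℤ/2)^ℚ`, and its steps are
the Dedekind cuts of uniform random real numbers. The cuts form a Sidon set `S`: for `w ≠ 0` only
finitely many of them lie in `w + S`. Hence distinct translates of `S` are almost surely told apart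
by a single step.
-/

namespace GraphLimit

section Ultralimits

variable {ι : Type*} {𝒰 : Ultrafilter ι}

/-- The limit of a family in `[0, ∞]` along an ultrafilter; it always exists by compactness. -/
noncomputable def ulim (𝒰 : Ultrafilter ι) (f : ι → ℝ≥0∞) : ℝ≥0∞ :=
  limUnder (𝒰 : Filter ι) f

theorem tendsto_ulim (f : ι → ℝ≥0∞) : Tendsto f 𝒰 (𝓝 (ulim 𝒰 f)) :=
  (𝒰.map f).le_nhds_lim

theorem ulim_eq {f : ι → ℝ≥0∞} {a : ℝ≥0∞} (h : Tendsto f 𝒰 (𝓝 a)) : ulim 𝒰 f = a :=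
  h.limUnder_eq

theorem ulim_const (a : ℝ≥0∞) : ulim 𝒰 (fun _ => a) = a :=
  ulim_eq tendsto_const_nhds

theorem ulim_congr {f g : ι → ℝ≥0∞} (h : ∀ᶠ i in 𝒰, f i = g i) : ulim 𝒰 f = ulim 𝒰 g :=
  ulim_eq ((tendsto_congr' h).2 (tendsto_ulim g))

theorem ulim_mono {f g : ι → ℝ≥0∞} (h : ∀ᶠ i in 𝒰, f i ≤ g i) : ulim 𝒰 f ≤ ulim 𝒰 g :=
  le_of_tendsto_of_tendsto (tendsto_ulim f) (tendsto_ulim g) h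

theorem ulim_le {f : ι → ℝ≥0∞} {a : ℝ≥0∞} (h : ∀ i, f i ≤ a) : ulim 𝒰 f ≤ a :=
  le_of_tendsto' (tendsto_ulim f) h

theorem ulim_add (f g : ι → ℝ≥0∞) : ulim 𝒰 (fun i => f i + g i) = ulim 𝒰 f + ulim 𝒰 g :=
  ulim_eq ((tendsto_ulim f).add (tendsto_ulim g))

theorem ulim_sum {κ : Type*} (s : Finset κ) (f : κ → ι → ℝ≥0∞) :
    ulim 𝒰 (fun i => ∑ k ∈ s, f k i) = ∑ k ∈ s, ulim 𝒰 (f k) :=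
  ulim_eq (tendsto_finsetSum s fun k _ => tendsto_ulim (f k))

theorem ulim_const_mul {c : ℝ≥0∞} (hc : c ≠ ∞) (f : ι → ℝ≥0∞) :
    ulim 𝒰 (fun i => c * f i) = c * ulim 𝒰 f :=
  ulim_eq (ENNReal.Tendsto.const_mul (tendsto_ulim f) (Or.inr hc))

/-- An ultrafilter is countably incomplete if it is not closed under countable intersections.
This is encoded by a function to `ℕ` that tends to infinity along the ultrafilter. -/
class CountablyIncomplete (𝒰 : Ultrafilter ι) : Prop where
  exists_tendsto_atTop : ∃ r : ι → ℕ, Tendsto r 𝒰 atTop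

instance : CountablyIncomplete (hyperfilter ℕ) :=
  ⟨id, Nat.hyperfilter_le_atTop⟩

end Ultralimits

section InternalSets

variable {ι : Type*} {𝒰 : Ultrafilter ι} {W : ι → Type*}

/-- The ultraproduct of a family of types. Its points are represented by families of points;
families that are equal `𝒰`-almost everywhere are not identified, but no measurable set
distinguishes them. -/
def Ultraproduct (_𝒰 : Ultrafilter ι) (W : ι → Type*) : Type _ := ∀ i, W i

/-- The ultraproduct of a family of sets, as a subset of the ultraproduct of the ambient types. -/
def internalSet (𝒰 : Ultrafilter ι) (A : ∀ i, Set (W i)) : Set (Ultraproduct 𝒰 W) :=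
  {x | ∀ᶠ i in 𝒰, x i ∈ A i}

theorem internalSet_univ : internalSet 𝒰 (fun i => (Set.univ : Set (W i))) = Set.univ := by
  simp [internalSet]

theorem internalSet_empty : internalSet 𝒰 (fun i => (∅ : Set (W i))) = ∅ := by
  simp [internalSet, 𝒰.neBot.ne]

theorem internalSet_inter (A B : ∀ i, Set (W i)) :
    internalSet 𝒰 (fun i => A i ∩ B i) = internalSet 𝒰 A ∩ internalSet 𝒰 B := by
  ext x
  exact eventually_and

theorem internalSet_union (A B : ∀ i, Set (W i)) :
    internalSet 𝒰 (fun i => A i ∪ B i) = internalSet 𝒰 A ∪ internalSet 𝒰 B := by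
  ext x
  exact Ultrafilter.eventually_or

theorem internalSet_compl (A : ∀ i, Set (W i)) :
    internalSet 𝒰 (fun i => (A i)ᶜ) = (internalSet 𝒰 A)ᶜ := by
  ext x
  exact Ultrafilter.eventually_not

theorem internalSet_sdiff (A B : ∀ i, Set (W i)) :
    internalSet 𝒰 (fun i => A i \ B i) = internalSet 𝒰 A \ internalSet 𝒰 B := by
  ext x
  exact eventually_and.trans (and_congr_right fun _ => Ultrafilter.eventually_not)

theorem ulim_indicator (A : ∀ i, Set (W i)) (f : ∀ i, W i → ℝ≥0∞) (x : Ultraproduct 𝒰 W) :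
    ulim 𝒰 (fun i => (A i).indicator (f i) (x i)) =
      (internalSet 𝒰 A).indicator (fun x => ulim 𝒰 fun i => f i (x i)) x := by
  by_cases hx : x ∈ internalSet 𝒰 A
  · rw [Set.indicator_of_mem hx]
    exact ulim_congr (Eventually.mono hx fun i hi => Set.indicator_of_mem hi _)
  · rw [Set.indicator_of_notMem hx, ← ulim_const 0]
    exact ulim_congr <|
      (Ultrafilter.eventually_not.2 hx).mono fun i hi => Set.indicator_of_notMem hi _

theorem eventually_subset_of_internalSet_subset_iUnion [CountablyIncomplete 𝒰]
    [∀ i, Nonempty (W i)] {A : ∀ i, Set (W i)} {B : ℕ → ∀ i, Set (W i)}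
    (h : internalSet 𝒰 A ⊆ ⋃ k, internalSet 𝒰 (B k)) :
    ∃ K, ∀ᶠ i in 𝒰, A i ⊆ ⋃ k ∈ Finset.range K, B k i := by
  classical
  by_contra! hcon
  let Uncovered (i : ι) (K : ℕ) : Prop := ∃ y ∈ A i, ∀ k < K, y ∉ B k i
  have uncovered (K : ℕ) : ∀ᶠ i in 𝒰, Uncovered i K := by
    filter_upwards [hcon K] with i hi
    obtain ⟨y, hyA, hyB⟩ := Set.not_subset.1 hi
    exact ⟨y, hyA, by simpa using hyB⟩
  obtain ⟨r, hr⟩ := CountablyIncomplete.exists_tendsto_atTop (𝒰 := 𝒰)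
  -- Diagonalization: `x i` avoids as many of the first `r i` sets `B k i` as possible.
  let K (i : ι) : ℕ := Nat.findGreatest (Uncovered i) (r i)
  have (i : ι) : ∃ y : W i, Uncovered i (K i) → y ∈ A i ∧ ∀ k < K i, y ∉ B k i :=
    (em (Uncovered i (K i))).elim (fun ⟨y, hy⟩ => ⟨y, fun _ => hy⟩)
      fun hi => ⟨Classical.arbitrary _, fun h => absurd h hi⟩
  choose x hx using this
  have hxA : x ∈ internalSet 𝒰 A := (uncovered 0).mono fun i hi =>
    (hx i (Nat.findGreatest_spec (Nat.zero_le _) hi)).1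
  obtain ⟨k, hk⟩ := Set.mem_iUnion.1 (h hxA)
  have : ∀ᶠ _ in (𝒰 : Filter ι), False := by
    filter_upwards [hk, hr.eventually_ge_atTop (k + 1), uncovered (k + 1)] with i hxB hri hi
    exact (hx i (Nat.findGreatest_spec hri hi)).2 k (Nat.le_findGreatest hri hi) hxB
  exact this.exists.choose_spec

theorem internalSet_nonempty_iff [∀ i, Nonempty (W i)] {A : ∀ i, Set (W i)} :
    (internalSet 𝒰 A).Nonempty ↔ ∀ᶠ i in 𝒰, (A i).Nonempty := by
  refine ⟨fun ⟨x, hx⟩ => Eventually.mono hx fun i hi => ⟨x i, hi⟩, fun h => ?_⟩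
  have (i : ι) (hi : (A i).Nonempty) : ∃ y, y ∈ A i := hi
  choose! x hx using this
  exact ⟨x, h.mono hx⟩

theorem eventually_disjoint_of_disjoint_internalSet [∀ i, Nonempty (W i)] {A B : ∀ i, Set (W i)}
    (h : Disjoint (internalSet 𝒰 A) (internalSet 𝒰 B)) : ∀ᶠ i in 𝒰, Disjoint (A i) (B i) := by
  rw [Set.disjoint_iff_inter_eq_empty, ← internalSet_inter, ← Set.not_nonempty_iff_eq_empty,
    internalSet_nonempty_iff, ← Ultrafilter.eventually_not] at h
  exact h.mono fun i => Set.disjoint_iff_inter_eq_empty.2 ∘ Set.not_nonempty_iff_eq_empty.1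

theorem eventually_eq_of_internalSet_eq [∀ i, Nonempty (W i)] {A B : ∀ i, Set (W i)}
    (h : internalSet 𝒰 A = internalSet 𝒰 B) : ∀ᶠ i in 𝒰, A i = B i := by
  have eventually_subset {A B : ∀ i, Set (W i)} (h : internalSet 𝒰 A ⊆ internalSet 𝒰 B) :
      ∀ᶠ i in 𝒰, A i ⊆ B i := by
    have : Disjoint (internalSet 𝒰 A) (internalSet 𝒰 fun i => (B i)ᶜ) := by
      simpa only [internalSet_compl] using Set.disjoint_compl_right_iff_subset.2 h
    exact (eventually_disjoint_of_disjoint_internalSet this).mono fun i =>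
      Set.disjoint_compl_right_iff_subset.1
  filter_upwards [eventually_subset h.le, eventually_subset h.ge] with i using subset_antisymm

variable [∀ i, MeasurableSpace (W i)]

/-- The algebra of the ultraproducts of families of measurable sets, which generates the
σ-algebra of the ultraproduct. -/
def internalAlgebra (𝒰 : Ultrafilter ι) (W : ι → Type*) [∀ i, MeasurableSpace (W i)] :
    Set (Set (Ultraproduct 𝒰 W)) :=
  internalSet 𝒰 '' {A | ∀ i, MeasurableSet (A i)}

instance : MeasurableSpace (Ultraproduct 𝒰 W) :=
  MeasurableSpace.generateFrom (internalAlgebra 𝒰 W)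

theorem internalSet_mem_internalAlgebra {A : ∀ i, Set (W i)} (hA : ∀ i, MeasurableSet (A i)) :
    internalSet 𝒰 A ∈ internalAlgebra 𝒰 W :=
  Set.mem_image_of_mem _ hA

theorem measurableSet_internalSet {A : ∀ i, Set (W i)} (hA : ∀ i, MeasurableSet (A i)) :
    MeasurableSet (internalSet 𝒰 A) :=
  MeasurableSpace.measurableSet_generateFrom (internalSet_mem_internalAlgebra hA)

theorem univ_mem_internalAlgebra : Set.univ ∈ internalAlgebra 𝒰 W :=
  ⟨_, fun _ => .univ, internalSet_univ⟩

theorem isSetRing_internalAlgebra : IsSetRing (internalAlgebra 𝒰 W) where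
  empty_mem := ⟨_, fun _ => .empty, internalSet_empty⟩
  union_mem := by
    rintro _ _ ⟨A, hA, rfl⟩ ⟨B, hB, rfl⟩
    exact ⟨_, fun i => (hA i).union (hB i), internalSet_union A B⟩
  sdiff_mem := by
    rintro _ _ ⟨A, hA, rfl⟩ ⟨B, hB, rfl⟩
    exact ⟨_, fun i => (hA i).diff (hB i), internalSet_sdiff A B⟩

theorem isPiSystem_internalAlgebra : IsPiSystem (internalAlgebra 𝒰 W) :=
  fun _ hs _ ht _ => isSetRing_internalAlgebra.inter_mem hs ht

theorem measurable_ulim {f : ∀ i, W i → ℝ≥0∞} (hf : ∀ i, Measurable (f i)) :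
    Measurable fun x : Ultraproduct 𝒰 W => ulim 𝒰 fun i => f i (x i) := by
  refine measurable_of_Ioi fun a => ?_
  have preimage_eq : (fun x : Ultraproduct 𝒰 W => ulim 𝒰 fun i => f i (x i)) ⁻¹' Set.Ioi a =
      ⋃ q ∈ {q : ℚ | a < ENNReal.ofReal q},
        internalSet 𝒰 fun i => f i ⁻¹' Set.Ici (ENNReal.ofReal q) := by
    ext x
    simp only [Set.mem_preimage, Set.mem_Ioi, Set.mem_iUnion]
    refine ⟨fun hx => ?_, fun ⟨q, hq, hx⟩ => hq.trans_le (ge_of_tendsto (tendsto_ulim _) hx)⟩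
    obtain ⟨q, -, haq, hqx⟩ := ENNReal.lt_iff_exists_rat_btwn.1 hx
    exact ⟨q, haq, ((tendsto_ulim _).eventually_const_lt hqx).mono fun i => le_of_lt⟩
  rw [preimage_eq]
  exact MeasurableSet.biUnion (Set.to_countable _) fun q _ =>
    measurableSet_internalSet fun i => hf i measurableSet_Ici

end InternalSets

section LoebMeasure

variable {ι : Type*} {𝒰 : Ultrafilter ι} {W : ι → Type*} [∀ i, Nonempty (W i)]
  [∀ i, MeasurableSpace (W i)]

/-- The ultralimit of a family of measures, as a function on internal sets; its value at all other
sets is `0`. -/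
noncomputable def loebContent (𝒰 : Ultrafilter ι) (μ : ∀ i, Measure (W i)) :
    Set (Ultraproduct 𝒰 W) → ℝ≥0∞ :=
  Function.extend (internalSet 𝒰) (fun A => ulim 𝒰 fun i => μ i (A i)) 0

theorem loebContent_internalSet (μ : ∀ i, Measure (W i)) (A : ∀ i, Set (W i)) :
    loebContent 𝒰 μ (internalSet 𝒰 A) = ulim 𝒰 fun i => μ i (A i) :=
  Function.FactorsThrough.extend_apply
    (fun _ _ h => ulim_congr ((eventually_eq_of_internalSet_eq h).mono fun i hi => by rw [hi])) 0 A

/-- The ultralimit of a family of measures, as an additive content on the internal algebra. -/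
noncomputable def loebAddContent (𝒰 : Ultrafilter ι) (μ : ∀ i, Measure (W i)) :
    AddContent ℝ≥0∞ (internalAlgebra 𝒰 W) :=
  isSetRing_internalAlgebra.addContent_of_union (loebContent 𝒰 μ)
    (by simp only [← internalSet_empty, loebContent_internalSet, measure_empty, ulim_const])
    (by
      rintro _ _ ⟨A, -, rfl⟩ ⟨B, hB, rfl⟩ disjoint_AB
      simp only [← internalSet_union, loebContent_internalSet, ← ulim_add]
      exact ulim_congr <| (eventually_disjoint_of_disjoint_internalSet disjoint_AB).mono
        fun i hi => measure_union hi (hB i))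

theorem isSigmaSubadditive_loebAddContent [CountablyIncomplete 𝒰] (μ : ∀ i, Measure (W i)) :
    (loebAddContent 𝒰 μ).IsSigmaSubadditive := by
  intro f hf hU
  obtain ⟨A, -, hA⟩ := hU
  choose B _ hB using hf
  obtain rfl : (fun k => internalSet 𝒰 (B k)) = f := funext hB
  obtain ⟨K, hK⟩ := eventually_subset_of_internalSet_subset_iUnion hA.subset
  calc loebContent 𝒰 μ (⋃ k, internalSet 𝒰 (B k)) = ulim 𝒰 (fun i => μ i (A i)) := by
        rw [← hA, loebContent_internalSet]
    _ ≤ ulim 𝒰 (fun i => ∑ k ∈ Finset.range K, μ i (B k i)) :=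
        ulim_mono <| hK.mono fun i hi =>
          (measure_mono hi).trans (measure_biUnion_finset_le _ _)
    _ = ∑ k ∈ Finset.range K, loebContent 𝒰 μ (internalSet 𝒰 (B k)) := by
        simp only [loebContent_internalSet, ulim_sum]
    _ ≤ _ := ENNReal.sum_le_tsum _

/-- The Loeb measure of a family of measures: the measure on the ultraproduct that assigns to the
ultraproduct of a family of measurable sets the ultralimit of their measures. -/
noncomputable def loebMeasure (𝒰 : Ultrafilter ι) [CountablyIncomplete 𝒰]
    (μ : ∀ i, Measure (W i)) : Measure (Ultraproduct 𝒰 W) :=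
  (loebAddContent 𝒰 μ).measure isSetRing_internalAlgebra.isSetSemiring le_rfl
    (isSigmaSubadditive_loebAddContent μ)

variable [CountablyIncomplete 𝒰]

theorem loebMeasure_internalSet (μ : ∀ i, Measure (W i)) {A : ∀ i, Set (W i)}
    (hA : ∀ i, MeasurableSet (A i)) :
    loebMeasure 𝒰 μ (internalSet 𝒰 A) = ulim 𝒰 fun i => μ i (A i) :=
  ((loebAddContent 𝒰 μ).measure_eq _ rfl _ (internalSet_mem_internalAlgebra hA)).trans
    (loebContent_internalSet μ A)

theorem loebMeasure_univ (μ : ∀ i, Measure (W i)) :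
    loebMeasure 𝒰 μ Set.univ = ulim 𝒰 fun i => μ i Set.univ := by
  rw [← internalSet_univ, loebMeasure_internalSet μ fun _ => .univ]

instance (μ : ∀ i, Measure (W i)) [∀ i, IsProbabilityMeasure (μ i)] :
    IsProbabilityMeasure (loebMeasure 𝒰 μ) :=
  ⟨by simp only [loebMeasure_univ, measure_univ, ulim_const]⟩

/-- The step function with step `c` and `M` steps below the identity of `[0, ∞]`. -/
noncomputable def stepFunction (c : ℝ≥0∞) (M : ℕ) (a : ℝ≥0∞) : ℝ≥0∞ :=
  ∑ j ∈ Finset.range M, (Set.Ici ((j + 1) * c)).indicator (fun _ => c) a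

theorem stepFunction_succ (c : ℝ≥0∞) (M : ℕ) (a : ℝ≥0∞) :
    stepFunction c (M + 1) a =
      stepFunction c M a + (Set.Ici ((M + 1) * c)).indicator (fun _ => c) a :=
  Finset.sum_range_succ _ _

theorem stepFunction_of_le {c a : ℝ≥0∞} {M : ℕ} (h : M * c ≤ a) : stepFunction c M a = M * c := by
  have mem (j : ℕ) (hj : j ∈ Finset.range M) : a ∈ Set.Ici ((j + 1) * c) := by
    refine Set.mem_Ici.2 (le_trans ?_ h)
    gcongr
    exact_mod_cast Finset.mem_range.1 hj
  rw [stepFunction, Finset.sum_congr rfl fun j hj => Set.indicator_of_mem (mem j hj) _,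
    Finset.sum_const, Finset.card_range, nsmul_eq_mul]

theorem stepFunction_le (c : ℝ≥0∞) (M : ℕ) (a : ℝ≥0∞) : stepFunction c M a ≤ a := by
  induction M with
  | zero => simp [stepFunction]
  | succ M ih =>
    by_cases h : (M + 1 : ℕ) * c ≤ a
    · exact (stepFunction_of_le h).trans_le h
    · rwa [stepFunction_succ, Set.indicator_of_notMem (by simpa using h), add_zero]

theorem le_stepFunction_add {c a : ℝ≥0∞} {M : ℕ} (h : a ≤ M * c) : a ≤ stepFunction c M a + c := by
  induction M with
  | zero => simp_all
  | succ M ih =>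
    rw [stepFunction_succ]
    rcases le_total (M * c) a with hM | hM
    · rw [stepFunction_of_le hM]
      refine h.trans ?_
      rw [Nat.cast_succ, add_one_mul]
      gcongr
      exact le_self_add
    · exact (ih hM).trans (by gcongr; exact le_self_add)

theorem lintegral_ulim_stepFunction {μ : ∀ i, Measure (W i)} {f : ∀ i, W i → ℝ≥0∞}
    (hf : ∀ i, Measurable (f i)) {c : ℝ≥0∞} (hc : c ≠ ∞) (M : ℕ) :
    ∫⁻ x, ulim 𝒰 (fun i => stepFunction c M (f i (x i))) ∂loebMeasure 𝒰 μ =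
      ulim 𝒰 fun i => ∫⁻ y, stepFunction c M (f i y) ∂μ i := by
  let A (j : ℕ) (i : ι) : Set (W i) := f i ⁻¹' Set.Ici ((j + 1) * c)
  have measurableSet_A (j : ℕ) (i : ι) : MeasurableSet (A j i) := hf i measurableSet_Ici
  have stepFunction_eq (i : ι) (y : W i) :
      stepFunction c M (f i y) = ∑ j ∈ Finset.range M, (A j i).indicator (fun _ => c) y := rfl
  simp only [stepFunction_eq, ulim_sum, ulim_indicator, ulim_const]
  rw [lintegral_finsetSum _ fun j _ =>
    measurable_const.indicator (measurableSet_internalSet (measurableSet_A j))]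
  simp only [lintegral_finsetSum _ fun j _ => measurable_const.indicator (measurableSet_A j _),
    ulim_sum]
  refine Finset.sum_congr rfl fun j _ => ?_
  simp only [lintegral_indicator_const (measurableSet_A j _)]
  rw [lintegral_indicator_const (measurableSet_internalSet (measurableSet_A j)),
    loebMeasure_internalSet μ (measurableSet_A j), ulim_const_mul hc]

theorem le_of_forall_le_add_mul {a b m : ℝ≥0∞} (hm : m ≠ ∞)
    (h : ∀ c, c ≠ 0 → c ≠ ∞ → a ≤ b + c * m) : a ≤ b := by
  have limit : Tendsto (fun c => b + c * m) (𝓝[>] 0) (𝓝 (b + 0 * m)) :=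
    tendsto_const_nhds.add
      (ENNReal.Tendsto.mul_const (tendsto_id.mono_left nhdsWithin_le_nhds) (Or.inr hm))
  rw [zero_mul, add_zero] at limit
  refine ge_of_tendsto limit ?_
  filter_upwards [Ioo_mem_nhdsGT ENNReal.zero_lt_top] with c hc using h c hc.1.ne' hc.2.ne

theorem lintegral_ulim {μ : ∀ i, Measure (W i)} [IsFiniteMeasure (loebMeasure 𝒰 μ)]
    {f : ∀ i, W i → ℝ≥0∞} (hf : ∀ i, Measurable (f i)) {C : ℝ≥0∞} (hC : C ≠ ∞)
    (hfC : ∀ i y, f i y ≤ C) :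
    ∫⁻ x, ulim 𝒰 (fun i => f i (x i)) ∂loebMeasure 𝒰 μ = ulim 𝒰 fun i => ∫⁻ y, f i y ∂μ i := by
  have approx {c : ℝ≥0∞} (hc0 : c ≠ 0) : ∃ M, ∀ i y, f i y ≤ stepFunction c M (f i y) + c :=
    (ENNReal.exists_nat_mul_gt hc0 hC).imp fun _ hM i y =>
      le_stepFunction_add ((hfC i y).trans hM.le)
  have loeb_ne_top := measure_ne_top (loebMeasure 𝒰 μ) Set.univ
  apply le_antisymm
  · refine le_of_forall_le_add_mul loeb_ne_top fun c hc0 hc => ?_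
    obtain ⟨M, hM⟩ := approx hc0
    calc ∫⁻ x, ulim 𝒰 (fun i => f i (x i)) ∂loebMeasure 𝒰 μ
      _ ≤ ∫⁻ x, (ulim 𝒰 (fun i => stepFunction c M (f i (x i))) + c) ∂loebMeasure 𝒰 μ := by
        refine lintegral_mono fun x => ?_
        rw [← ulim_const c, ← ulim_add, ulim_const c]
        exact ulim_mono (.of_forall fun i => hM i _)
      _ = ulim 𝒰 (fun i => ∫⁻ y, stepFunction c M (f i y) ∂μ i) +
          c * loebMeasure 𝒰 μ Set.univ := by
        rw [lintegral_add_right _ measurable_const, lintegral_ulim_stepFunction hf hc,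
          lintegral_const]
      _ ≤ _ := by
        gcongr
        exact ulim_mono (.of_forall fun i => lintegral_mono fun y => stepFunction_le ..)
  · refine le_of_forall_le_add_mul loeb_ne_top fun c hc0 hc => ?_
    obtain ⟨M, hM⟩ := approx hc0
    calc ulim 𝒰 (fun i => ∫⁻ y, f i y ∂μ i)
      _ ≤ ulim 𝒰 (fun i => ∫⁻ y, stepFunction c M (f i y) ∂μ i + c * μ i Set.univ) := by
        refine ulim_mono (.of_forall fun i => ?_)
        rw [← lintegral_const, ← lintegral_add_right _ measurable_const]
        exact lintegral_mono (hM i)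
      _ = ∫⁻ x, ulim 𝒰 (fun i => stepFunction c M (f i (x i))) ∂loebMeasure 𝒰 μ +
          c * loebMeasure 𝒰 μ Set.univ := by
        rw [ulim_add, ulim_const_mul hc, loebMeasure_univ, lintegral_ulim_stepFunction hf hc]
      _ ≤ _ := by
        gcongr
        exact ulim_mono (.of_forall fun i => stepFunction_le ..)

end LoebMeasure

section Kernels

variable {X : Type*} [mX : MeasurableSpace X] {κ : Kernel X X}

theorem isReversible_of_isPiSystem {C : Set (Set X)} (hC : mX = MeasurableSpace.generateFrom C)
    (isPiSystem_C : IsPiSystem C) (univ_mem : Set.univ ∈ C) [IsFiniteKernel κ]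
    {P : Measure X} [IsFiniteMeasure P]
    (h : ∀ A ∈ C, ∀ B ∈ C, ∫⁻ x in A, κ x B ∂P = ∫⁻ x in B, κ x A ∂P) : κ.IsReversible P := by
  have measurableSet_of_mem {A : Set X} (hA : A ∈ C) : MeasurableSet A :=
    hC ▸ MeasurableSpace.measurableSet_generateFrom hA
  -- Both sides are finite measures in `A`, so that it suffices to compare them on `C`.
  have extend_left {B : Set X}
      (hB : ∀ A ∈ C, ∫⁻ x in A, κ x B ∂P = ∫⁻ x in B, κ x A ∂P) {A : Set X}
      (hA : MeasurableSet A) : ∫⁻ x in A, κ x B ∂P = ∫⁻ x in B, κ x A ∂P := by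
    have : P.withDensity (fun x => κ x B) = κ ∘ₘ P.restrict B := by
      refine (ext_of_generate_finite C hC isPiSystem_C (fun A hA => ?_) ?_).symm
      · rw [Measure.bind_apply (measurableSet_of_mem hA) κ.aemeasurable,
          withDensity_apply _ (measurableSet_of_mem hA), hB A hA]
      · rw [Measure.bind_apply .univ κ.aemeasurable, withDensity_apply _ .univ, hB _ univ_mem]
    rw [← withDensity_apply _ hA, this, Measure.bind_apply hA κ.aemeasurable]
  intro A B hA hB
  exact extend_left (fun A hA => (extend_left (fun B hB => h B hB A hA) hB).symm) hA

theorem IsSubMarkov.isFiniteKernel (hκ : IsSubMarkov κ) : IsFiniteKernel κ :=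
  ⟨1, ENNReal.one_lt_top, hκ⟩

variable {U : Type*} (parent : U → U) (l : List U)

open Classical in
theorem iteratedIntegral_cons (v : U) (x : U → X) :
    iteratedIntegral κ parent (v :: l) x =
      ∫⁻ y, iteratedIntegral κ parent l (Function.update x v y) ∂κ (x (parent v)) :=
  rfl

theorem iteratedIntegral_le_one (hκ : IsSubMarkov κ) (x : U → X) :
    iteratedIntegral κ parent l x ≤ 1 := by
  induction l generalizing x with
  | nil => exact le_rfl
  | cons v l ih =>
    calc iteratedIntegral κ parent (v :: l) x
      _ ≤ ∫⁻ _, 1 ∂κ (x (parent v)) := lintegral_mono fun _ => ih _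
      _ ≤ 1 := by rw [lintegral_one]; exact hκ _

theorem measurable_iteratedIntegral [IsSFiniteKernel κ] :
    Measurable (iteratedIntegral κ parent l) := by
  classical
  induction l with
  | nil => exact measurable_const
  | cons v l ih =>
    exact (ih.comp measurable_update').lintegral_kernel_prod_right'
      (κ := κ.comap (fun x : U → X => x (parent v)) (measurable_pi_apply _))

variable {F : SimpleGraph U} (L : AdmissibleLabeling F)

theorem measurable_rootedTreeDensity [IsSFiniteKernel κ] : Measurable (rootedTreeDensity L κ) :=
  (measurable_iteratedIntegral _ _).comp (measurable_pi_lambda _ fun _ => measurable_id)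

theorem rootedTreeDensity_le_one (hκ : IsSubMarkov κ) (x : X) : rootedTreeDensity L κ x ≤ 1 :=
  iteratedIntegral_le_one _ _ hκ _

end Kernels

section LoebKernels

variable {ι : Type*} {𝒰 : Ultrafilter ι} [CountablyIncomplete 𝒰] {W : ι → Type*}
  [∀ i, Nonempty (W i)] [∀ i, MeasurableSpace (W i)] {κ : ∀ i, Kernel (W i) (W i)}

theorem loebMeasure_kernel_univ_le_one (hκ : ∀ i, IsSubMarkov (κ i)) (x : Ultraproduct 𝒰 W) :
    loebMeasure 𝒰 (fun i => κ i (x i)) Set.univ ≤ 1 := by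
  rw [loebMeasure_univ]
  exact ulim_le fun i => hκ i (x i)

/-- The ultraproduct of a family of sub-Markov kernels. -/
noncomputable def loebKernel (𝒰 : Ultrafilter ι) [CountablyIncomplete 𝒰]
    (hκ : ∀ i, IsSubMarkov (κ i)) : Kernel (Ultraproduct 𝒰 W) (Ultraproduct 𝒰 W) where
  toFun x := loebMeasure 𝒰 fun i => κ i (x i)
  measurable' := by
    have (x : Ultraproduct 𝒰 W) : IsFiniteMeasure (loebMeasure 𝒰 fun i => κ i (x i)) :=
      ⟨(loebMeasure_kernel_univ_le_one hκ x).trans_lt ENNReal.one_lt_top⟩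
    refine Measurable.measure_of_isPiSystem rfl isPiSystem_internalAlgebra ?_ ?_
    · rintro _ ⟨A, hA, rfl⟩
      simp only [loebMeasure_internalSet _ hA]
      exact measurable_ulim (f := fun i y => κ i y (A i)) fun i => (κ i).measurable_coe (hA i)
    · simp only [loebMeasure_univ]
      exact measurable_ulim (f := fun i y => κ i y Set.univ) fun i => (κ i).measurable_coe .univ

theorem loebKernel_apply (hκ : ∀ i, IsSubMarkov (κ i)) (x : Ultraproduct 𝒰 W) :
    loebKernel 𝒰 hκ x = loebMeasure 𝒰 fun i => κ i (x i) :=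
  rfl

theorem isSubMarkov_loebKernel (hκ : ∀ i, IsSubMarkov (κ i)) : IsSubMarkov (loebKernel 𝒰 hκ) :=
  loebMeasure_kernel_univ_le_one hκ

theorem setLIntegral_loebKernel (hκ : ∀ i, IsSubMarkov (κ i)) (P : ∀ i, Measure (W i))
    [IsFiniteMeasure (loebMeasure 𝒰 P)] {A B : ∀ i, Set (W i)} (hA : ∀ i, MeasurableSet (A i))
    (hB : ∀ i, MeasurableSet (B i)) :
    ∫⁻ x in internalSet 𝒰 A, loebKernel 𝒰 hκ x (internalSet 𝒰 B) ∂loebMeasure 𝒰 P =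
      ulim 𝒰 fun i => ∫⁻ y in A i, κ i y (B i) ∂P i := by
  have indicator_eq (x : Ultraproduct 𝒰 W) :
      (internalSet 𝒰 A).indicator (fun x => loebKernel 𝒰 hκ x (internalSet 𝒰 B)) x =
        ulim 𝒰 fun i => (A i).indicator (fun y => κ i y (B i)) (x i) := by
    simp only [ulim_indicator, loebKernel_apply, loebMeasure_internalSet _ hB]
  rw [← lintegral_indicator (measurableSet_internalSet hA), lintegral_congr indicator_eq,
    lintegral_ulim (fun i => ((κ i).measurable_coe (hB i)).indicator (hA i)) ENNReal.one_ne_top]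
  · simp only [lintegral_indicator (hA _)]
  · exact fun i => Set.indicator_le'
      (fun y _ => (measure_mono (Set.subset_univ _)).trans (hκ i y)) fun _ _ => zero_le_one

theorem isReversible_loebKernel (hκ : ∀ i, IsSubMarkov (κ i)) {P : ∀ i, Measure (W i)}
    [IsFiniteMeasure (loebMeasure 𝒰 P)] (h : ∀ i, (κ i).IsReversible (P i)) :
    (loebKernel 𝒰 hκ).IsReversible (loebMeasure 𝒰 P) := by
  have := (isSubMarkov_loebKernel (𝒰 := 𝒰) hκ).isFiniteKernel
  refine isReversible_of_isPiSystem rfl isPiSystem_internalAlgebra univ_mem_internalAlgebra ?_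
  rintro _ ⟨A, hA, rfl⟩ _ ⟨B, hB, rfl⟩
  simp only [setLIntegral_loebKernel hκ P hA hB, setLIntegral_loebKernel hκ P hB hA,
    fun i => h i (hA i) (hB i)]

theorem iteratedIntegral_loebKernel {U : Type*} (hκ : ∀ i, IsSubMarkov (κ i)) (parent : U → U)
    (l : List U) (x : U → Ultraproduct 𝒰 W) :
    iteratedIntegral (loebKernel 𝒰 hκ) parent l x =
      ulim 𝒰 fun i => iteratedIntegral (κ i) parent l fun u => x u i := by
  classical
  have (i : ι) := (hκ i).isFiniteKernel
  induction l generalizing x with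
  | nil => exact (ulim_const 1).symm
  | cons v l ih =>
    have : IsFiniteMeasure (loebMeasure 𝒰 fun i => κ i (x (parent v) i)) :=
      (isSubMarkov_loebKernel (𝒰 := 𝒰) hκ).isFiniteKernel.isFiniteMeasure _
    have eval_update (i : ι) (y : Ultraproduct 𝒰 W) : (fun u => Function.update x v y u i) =
        Function.update (fun u => x u i) v (y i) :=
      Function.comp_update (fun z : Ultraproduct 𝒰 W => z i) x v y
    simp only [iteratedIntegral_cons, ih, eval_update]
    exact lintegral_ulim
      (f := fun i y => iteratedIntegral (κ i) parent l (Function.update (fun u => x u i) v y))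
      (fun i => (measurable_iteratedIntegral parent l).comp (measurable_update _))
      ENNReal.one_ne_top fun i y => iteratedIntegral_le_one _ _ (hκ i) _

theorem tendsto_treeDensity_loebKernel {U : Type*} {F : SimpleGraph U} (L : AdmissibleLabeling F)
    (hκ : ∀ i, IsSubMarkov (κ i)) (P : ∀ i, Measure (W i)) [∀ i, IsProbabilityMeasure (P i)] :
    Tendsto (fun i => treeDensity L (κ i) (P i)) 𝒰
      (𝓝 (treeDensity L (loebKernel 𝒰 hκ) (loebMeasure 𝒰 P))) := by
  have (i : ι) := (hκ i).isFiniteKernel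
  have lintegral_eq : ∫⁻ x, rootedTreeDensity L (loebKernel 𝒰 hκ) x ∂loebMeasure 𝒰 P =
      ulim 𝒰 fun i => ∫⁻ y, rootedTreeDensity L (κ i) y ∂P i := by
    rw [← lintegral_ulim (fun i => measurable_rootedTreeDensity L) ENNReal.one_ne_top
      fun i => rootedTreeDensity_le_one L (hκ i)]
    exact lintegral_congr fun x => iteratedIntegral_loebKernel hκ _ _ _
  have lintegral_le : ∫⁻ x, rootedTreeDensity L (loebKernel 𝒰 hκ) x ∂loebMeasure 𝒰 P ≤ 1 := by
    simpa using lintegral_mono (μ := loebMeasure 𝒰 P)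
      (rootedTreeDensity_le_one L (isSubMarkov_loebKernel hκ))
  unfold treeDensity
  refine (ENNReal.tendsto_toReal (lintegral_le.trans_lt ENNReal.one_lt_top).ne).comp ?_
  rw [lintegral_eq]
  exact tendsto_ulim _

end LoebKernels

section Homomorphisms

variable {U V : Type*} {F : SimpleGraph U}

/-- The nodes other than the root, listed in the order of their labels. -/
noncomputable def AdmissibleLabeling.nonRoots (L : AdmissibleLabeling F) : List U :=
  (List.ofFn L.node).tail

theorem AdmissibleLabeling.length_nonRoots (L : AdmissibleLabeling F) :
    L.nonRoots.length = Nat.card U - 1 := by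
  simp [nonRoots]

theorem AdmissibleLabeling.nodup_nonRoots (L : AdmissibleLabeling F) : L.nonRoots.Nodup :=
  (List.nodup_ofFn.2 L.node.injective).tail

theorem AdmissibleLabeling.mem_nonRoots_iff (L : AdmissibleLabeling F) {v : U} :
    v ∈ L.nonRoots ↔ 0 < (L.node.symm v).val := by
  obtain ⟨i, rfl⟩ := L.node.surjective v
  rw [L.node.symm_apply_apply, nonRoots, List.mem_iff_getElem]
  constructor
  · rintro ⟨k, hk, hki⟩
    rw [List.getElem_tail, List.getElem_ofFn, L.node.apply_eq_iff_eq] at hki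
    exact hki ▸ k.succ_pos
  · intro hi
    refine ⟨i - 1, by simp; omega, ?_⟩
    simp [Nat.sub_add_cancel (Nat.one_le_of_lt hi)]

theorem AdmissibleLabeling.exists_notMem_nonRoots_iff [Finite U] [Nonempty U]
    (L : AdmissibleLabeling F) : ∃ o, ∀ v, v ∉ L.nonRoots ↔ v = o :=
  ⟨L.node ⟨0, Nat.card_pos⟩, fun v => by
    rw [L.mem_nonRoots_iff, Nat.pos_iff_ne_zero, not_not, ← L.node.symm_apply_eq, Fin.ext_iff]⟩

theorem AdmissibleLabeling.adj_parent (L : AdmissibleLabeling F) {v : U} (hv : v ∈ L.nonRoots) :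
    F.Adj (L.parent v) v := by
  simpa using L.parent_adj (L.node.symm v) (L.mem_nonRoots_iff.1 hv)

theorem AdmissibleLabeling.label_parent_lt (L : AdmissibleLabeling F) {v : U}
    (hv : v ∈ L.nonRoots) : L.node.symm (L.parent v) < L.node.symm v := by
  simpa using L.parent_lt (L.node.symm v) (L.mem_nonRoots_iff.1 hv)

theorem AdmissibleLabeling.pairwise_nonRoots (L : AdmissibleLabeling F) :
    L.nonRoots.Pairwise fun u v => L.parent u ≠ v := by
  have sorted : L.nonRoots.Pairwise fun u v => L.node.symm u < L.node.symm v :=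
    List.Pairwise.tail (List.pairwise_ofFn.2 fun i j hij => by simpa using hij)
  refine sorted.imp_of_mem fun hu _ huv h => ?_
  exact lt_asymm huv (h ▸ L.label_parent_lt hu)

theorem AdmissibleLabeling.injOn_parentEdge (L : AdmissibleLabeling F) :
    Set.InjOn (fun v => s(L.parent v, v)) {v | v ∈ L.nonRoots} := by
  intro v hv w hw hvw
  obtain ⟨-, h⟩ | ⟨hv', hw'⟩ := Sym2.eq_iff.1 hvw
  · exact h
  · exact absurd (hv' ▸ L.label_parent_lt hv) (hw' ▸ L.label_parent_lt hw).asymm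

theorem AdmissibleLabeling.edgeSet_eq [Finite U] (L : AdmissibleLabeling F) (hF : F.IsTree) :
    F.edgeSet = (fun v => s(L.parent v, v)) '' {v | v ∈ L.nonRoots} := by
  classical
  have := Fintype.ofFinite U
  have coe_toFinset : (L.nonRoots.toFinset : Set U) = {v | v ∈ L.nonRoots} := by ext; simp
  have subset : L.nonRoots.toFinset.image (fun v => s(L.parent v, v)) ⊆ F.edgeFinset := by
    intro e he
    obtain ⟨v, hv, rfl⟩ := Finset.mem_image.1 he
    exact SimpleGraph.mem_edgeFinset.2 (L.adj_parent (List.mem_toFinset.1 hv))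
  -- A tree has as many edges as it has nodes other than the root.
  have card_le : F.edgeFinset.card ≤
      (L.nonRoots.toFinset.image fun v => s(L.parent v, v)).card := by
    rw [Finset.card_image_of_injOn (coe_toFinset ▸ L.injOn_parentEdge),
      List.toFinset_card_of_nodup L.nodup_nonRoots, L.length_nonRoots,
      Nat.card_eq_fintype_card, ← hF.card_edgeFinset, Nat.add_sub_cancel]
  rw [← SimpleGraph.coe_edgeFinset, ← Finset.eq_of_subset_of_card_le subset card_le,
    Finset.coe_image, coe_toFinset]

theorem AdmissibleLabeling.le_comap_iff [Finite U] (L : AdmissibleLabeling F) (hF : F.IsTree)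
    {G : SimpleGraph V} {φ : U → V} :
    F ≤ G.comap φ ↔ ∀ v ∈ L.nonRoots, G.Adj (φ (L.parent v)) (φ v) := by
  rw [← SimpleGraph.edgeSet_subset_edgeSet, L.edgeSet_eq hF, Set.image_subset_iff]
  rfl

variable [Fintype U] [Fintype V]

open Classical in
/-- The maps that agree with `x` outside the list `l` and send the edges joining the nodes in `l`
to their parents to edges; the nodes outside `l` play the role of the nodes placed so far in
`iteratedIntegral`. -/
noncomputable def extensions (G : SimpleGraph V) (parent : U → U) (l : List U) (x : U → V) :
    Finset (U → V) :=
  {φ | (∀ u ∉ l, φ u = x u) ∧ ∀ v ∈ l, G.Adj (φ (parent v)) (φ v)}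

variable (G : SimpleGraph V) {parent : U → U}

theorem mem_extensions {l : List U} {x φ : U → V} :
    φ ∈ extensions G parent l x ↔
      (∀ u ∉ l, φ u = x u) ∧ ∀ v ∈ l, G.Adj (φ (parent v)) (φ v) := by
  simp [extensions]

theorem extensions_nil (x : U → V) : extensions G parent [] x = {x} := by
  ext φ
  simp [mem_extensions, funext_iff]

open Classical in
theorem mem_extensions_cons_iff {v : U} {l : List U} (hv : v ∉ l) (hp : parent v ∉ v :: l)
    {x φ : U → V} {y : V} :
    φ ∈ extensions G parent (v :: l) x ∧ φ v = y ↔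
      G.Adj (x (parent v)) y ∧ φ ∈ extensions G parent l (Function.update x v y) := by
  have agree_iff : (∀ u ∉ v :: l, φ u = x u) ∧ φ v = y ↔
      ∀ u ∉ l, φ u = Function.update x v y u := by
    simp only [Function.update_apply, List.mem_cons, not_or]
    grind
  rw [mem_extensions, mem_extensions, List.forall_mem_cons, and_right_comm, agree_iff,
    and_left_comm]
  refine and_congr_left_iff.2 fun ⟨hφ, _⟩ => ?_
  rw [hφ v hv, hφ _ (hp ∘ List.mem_cons_of_mem v), Function.update_self,
    Function.update_of_ne (List.ne_of_not_mem_cons hp)]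

open Classical in
theorem card_extensions_cons {v : U} {l : List U} (hv : v ∉ l) (hp : parent v ∉ v :: l)
    (x : U → V) :
    (extensions G parent (v :: l) x).card = ∑ y, if G.Adj (x (parent v)) y then
      (extensions G parent l (Function.update x v y)).card else 0 := by
  rw [Finset.card_eq_sum_card_fiberwise (f := fun φ => φ v) (t := Finset.univ) (by simp)]
  refine Finset.sum_congr rfl fun y _ => ?_
  split_ifs with hy
  · congr 1
    ext φ
    rw [Finset.mem_filter, mem_extensions_cons_iff G hv hp, and_iff_right hy]
  · rw [Finset.card_eq_zero, Finset.filter_eq_empty_iff]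
    exact fun φ hφ h => hy ((mem_extensions_cons_iff G hv hp).1 ⟨hφ, h⟩).1

theorem card_hom_eq_sum (L : AdmissibleLabeling F) (hF : F.IsTree) :
    Nat.card (F →g G) = ∑ x, (extensions G L.parent L.nonRoots fun _ => x).card := by
  classical
  have := hF.1.nonempty
  obtain ⟨o, ho⟩ := L.exists_notMem_nonRoots_iff
  let e : (F →g G) ≃ {φ : U → V // F ≤ G.comap φ} :=
    ⟨fun f => ⟨f, fun _ _ => f.map_adj⟩, fun φ => ⟨φ.1, fun h => φ.2 h⟩, fun _ => rfl, fun _ => rfl⟩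
  rw [Nat.card_congr e, Nat.card_eq_fintype_card, Fintype.card_subtype,
    Finset.card_eq_sum_card_fiberwise (f := fun φ => φ o) (t := Finset.univ) (by simp)]
  refine Finset.sum_congr rfl fun x _ => congrArg Finset.card ?_
  ext φ
  simp [mem_extensions, ho, L.le_comap_iff hF, and_comm]

end Homomorphisms

section FiniteGraphs

variable {U V : Type*} [MeasurableSpace V] [DiscreteMeasurableSpace V]

/-- The random walk kernel of a finite graph, killed so that every edge has weight `1 / d`. -/
noncomputable def graphKernel (G : SimpleGraph V) (d : ℝ) : Kernel V V where
  toFun x := (ENNReal.ofReal d)⁻¹ • Measure.count.restrict (G.neighborSet x)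
  measurable' := .of_discrete

theorem graphKernel_apply (G : SimpleGraph V) (d : ℝ) (x : V) :
    graphKernel G d x = (ENNReal.ofReal d)⁻¹ • Measure.count.restrict (G.neighborSet x) :=
  rfl

open Classical in
theorem lintegral_graphKernel [Fintype V] (G : SimpleGraph V) (d : ℝ) (x : V) (f : V → ℝ≥0∞) :
    ∫⁻ y, f y ∂graphKernel G d x =
      (ENNReal.ofReal d)⁻¹ * ∑ y, if G.Adj x y then f y else 0 := by
  rw [graphKernel_apply, lintegral_smul_measure, smul_eq_mul, ← lintegral_indicator .of_discrete,
    lintegral_count, tsum_fintype]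
  simp only [Set.indicator_apply, SimpleGraph.mem_neighborSet]

theorem isSubMarkov_graphKernel [Finite V] {G : SimpleGraph V} {d : ℝ}
    (h : IsAdmissiblePair G d) : IsSubMarkov (graphKernel G d) := by
  intro x
  have card_le : Measure.count (G.neighborSet x) ≤ ENNReal.ofReal d := by
    rw [Measure.count_apply .of_discrete, ← (Set.toFinite _).cast_ncard_eq, ENat.toENNReal_coe,
      ← ENNReal.ofReal_natCast]
    exact ENNReal.ofReal_le_ofReal (h.2 x)
  rw [graphKernel_apply, Measure.smul_apply, Measure.restrict_apply_univ, smul_eq_mul, mul_comm,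
    ← div_eq_mul_inv]
  exact ENNReal.div_le_of_le_mul' (by rwa [mul_one])

theorem lintegral_uniformOn_univ [Fintype V] (f : V → ℝ≥0∞) :
    ∫⁻ y, f y ∂uniformOn (Set.univ : Set V) = (Nat.card V : ℝ≥0∞)⁻¹ * ∑ y, f y := by
  simp [uniformOn, ProbabilityTheory.cond, lintegral_count, lintegral_smul_measure, tsum_fintype]

theorem isReversible_graphKernel [Finite V] (G : SimpleGraph V) (d : ℝ) :
    (graphKernel G d).IsReversible (uniformOn (Set.univ : Set V)) := by
  classical
  have := Fintype.ofFinite V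
  have setLIntegral_eq (A B : Set V) :
      ∫⁻ x in A, graphKernel G d x B ∂uniformOn (Set.univ : Set V) =
        (Nat.card V : ℝ≥0∞)⁻¹ * ((ENNReal.ofReal d)⁻¹ *
          ∑ x, ∑ y, if G.Adj x y ∧ x ∈ A ∧ y ∈ B then 1 else 0) := by
    rw [← lintegral_indicator .of_discrete, lintegral_uniformOn_univ,
      Finset.mul_sum (a := (ENNReal.ofReal d)⁻¹)]
    refine congrArg _ (Finset.sum_congr rfl fun x _ => ?_)
    by_cases hx : x ∈ A
    · simp only [Set.indicator_of_mem hx, ← lintegral_indicator_one .of_discrete,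
        lintegral_graphKernel, Set.indicator_apply, Pi.one_apply, hx, true_and, ite_and]
    · simp [hx]
  intro A B _ _
  rw [setLIntegral_eq, setLIntegral_eq, Finset.sum_comm]
  simp only [G.adj_comm, and_comm]

theorem iteratedIntegral_graphKernel [Fintype U] [Fintype V] (G : SimpleGraph V) (d : ℝ)
    {parent : U → U} {l : List U} (nodup : l.Nodup) (pairwise : l.Pairwise fun u v => parent u ≠ v)
    (parent_ne : ∀ v ∈ l, parent v ≠ v) (x : U → V) :
    iteratedIntegral (graphKernel G d) parent l x =
      (ENNReal.ofReal d)⁻¹ ^ l.length * (extensions G parent l x).card := by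
  induction l generalizing x with
  | nil => simp [iteratedIntegral, extensions_nil]
  | cons v l ih =>
    obtain ⟨hv, nodup⟩ := List.nodup_cons.1 nodup
    obtain ⟨parent_ne_of_mem, pairwise⟩ := List.pairwise_cons.1 pairwise
    obtain ⟨parent_v_ne, parent_ne⟩ := List.forall_mem_cons.1 parent_ne
    have hp : parent v ∉ v :: l :=
      List.not_mem_cons_of_ne_of_not_mem parent_v_ne fun h => parent_ne_of_mem _ h rfl
    rw [iteratedIntegral_cons, lintegral_graphKernel, card_extensions_cons G hv hp,
      List.length_cons, pow_succ', mul_assoc, Nat.cast_sum, Finset.mul_sum _ _ (_ ^ _)]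
    simp only [ih nodup pairwise parent_ne, Nat.cast_ite, Nat.cast_zero, mul_ite, mul_zero]

theorem treeDensity_graphKernel [Finite U] [Finite V] {F : SimpleGraph U} (hF : F.IsTree)
    (L : AdmissibleLabeling F) (G : SimpleGraph V) {d : ℝ} (hd : 0 ≤ d) :
    treeDensity L (graphKernel G d) (uniformOn Set.univ) = homDensity F G d := by
  have := Fintype.ofFinite U
  have := Fintype.ofFinite V
  have rootedTreeDensity_eq (x : V) : rootedTreeDensity L (graphKernel G d) x =
      (ENNReal.ofReal d)⁻¹ ^ (Nat.card U - 1) *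
        (extensions G L.parent L.nonRoots fun _ => x).card := by
    rw [← L.length_nonRoots]
    exact iteratedIntegral_graphKernel G d L.nodup_nonRoots L.pairwise_nonRoots
      (fun v hv => (L.adj_parent hv).ne) _
  rw [treeDensity, homDensity, lintegral_uniformOn_univ]
  simp only [rootedTreeDensity_eq]
  rw [← Finset.mul_sum, ← Nat.cast_sum, ← card_hom_eq_sum G L hF]
  simp only [ENNReal.toReal_mul, ENNReal.toReal_inv, ENNReal.toReal_natCast, ENNReal.toReal_pow,
    ENNReal.toReal_ofReal hd]
  rw [inv_pow, div_eq_mul_inv, mul_inv]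
  ring

end FiniteGraphs

section Products

variable {X Y : Type*} [MeasurableSpace X] [MeasurableSpace Y]

theorem IsSubMarkov.parallelComp {κ : Kernel X X} {η : Kernel Y Y} (hκ : IsSubMarkov κ)
    (hη : IsSubMarkov η) : IsSubMarkov (κ ∥ₖ η) := by
  have := hκ.isFiniteKernel
  have := hη.isFiniteKernel
  intro z
  rw [Kernel.parallelComp_apply_univ]
  exact mul_le_one' (hκ _) (hη _)

theorem isReversible_parallelComp {κ : Kernel X X} [IsFiniteKernel κ] {P : Measure X}
    [IsFiniteMeasure P] {η : Kernel Y Y} [IsFiniteKernel η] {Q : Measure Y} [IsFiniteMeasure Q]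
    (hκ : κ.IsReversible P) (hη : η.IsReversible Q) : (κ ∥ₖ η).IsReversible (P.prod Q) := by
  have setLIntegral_prod (A B : Set X) (A' B' : Set Y) (hB : MeasurableSet B)
      (hB' : MeasurableSet B') : ∫⁻ z in A ×ˢ A', (κ ∥ₖ η) z (B ×ˢ B') ∂P.prod Q =
        (∫⁻ x in A, κ x B ∂P) * ∫⁻ y in A', η y B' ∂Q := by
    rw [← Measure.prod_restrict, ← lintegral_prod_mul (κ.measurable_coe hB).aemeasurable
      (η.measurable_coe hB').aemeasurable]
    simp only [Kernel.parallelComp_apply, Measure.prod_prod]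
  refine isReversible_of_isPiSystem generateFrom_prod.symm isPiSystem_prod
    ⟨Set.univ, .univ, Set.univ, .univ, Set.univ_prod_univ⟩ ?_
  rintro _ ⟨A, hA, A', hA', rfl⟩ _ ⟨B, hB, B', hB', rfl⟩
  rw [setLIntegral_prod _ _ _ _ hB hB', setLIntegral_prod _ _ _ _ hA hA', hκ hA hB, hη hA' hB']

instance isSFiniteKernel_iterKernel (κ : Kernel X X) [IsSFiniteKernel κ] (k : ℕ) :
    IsSFiniteKernel (iterKernel κ k) := by
  induction k with
  | zero => exact inferInstanceAs (IsSFiniteKernel Kernel.id)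
  | succ k ih => exact inferInstanceAs (IsSFiniteKernel (κ ∘ₖ iterKernel κ k))

theorem iterKernel_parallelComp (κ : Kernel X X) [IsSFiniteKernel κ] (η : Kernel Y Y)
    [IsSFiniteKernel η] (k : ℕ) :
    iterKernel (κ ∥ₖ η) k = iterKernel κ k ∥ₖ iterKernel η k := by
  induction k with
  | zero => exact Kernel.id_parallelComp_id.symm
  | succ k ih => rw [iterKernel, ih, Kernel.parallelComp_comp_parallelComp, iterKernel, iterKernel]

theorem prod_mutuallySingular_prod {ν ν' : Measure Y} [SFinite ν] [SFinite ν'] (h : ν ⟂ₘ ν')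
    (μ μ' : Measure X) : μ.prod ν ⟂ₘ μ'.prod ν' := by
  obtain ⟨s, hs, hνs, hνs'⟩ := h
  refine ⟨Prod.snd ⁻¹' s, measurable_snd hs, ?_, ?_⟩
  · rw [← Set.univ_prod, Measure.prod_prod, hνs, mul_zero]
  · rw [← Set.preimage_compl, ← Set.univ_prod, Measure.prod_prod, hνs', mul_zero]

theorem IsAcyclicKernel.parallelComp (κ : Kernel X X) [IsSFiniteKernel κ] {η : Kernel Y Y}
    [IsSFiniteKernel η] {Q : Measure Y} (hη : IsAcyclicKernel η Q) (P : Measure X) :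
    IsAcyclicKernel (κ ∥ₖ η) (P.prod Q) := by
  filter_upwards [Measure.quasiMeasurePreserving_snd.ae hη] with z hz k hk
  rw [iterKernel_parallelComp, Kernel.parallelComp_apply, Kernel.parallelComp_apply]
  exact prod_mutuallySingular_prod (hz k hk) _ _

variable (κ : Kernel X X) [IsSFiniteKernel κ] (η : Kernel Y Y) [IsMarkovKernel η]

theorem iteratedIntegral_parallelComp {U : Type*} (parent : U → U) (l : List U) (z : U → X × Y) :
    iteratedIntegral (κ ∥ₖ η) parent l z = iteratedIntegral κ parent l (Prod.fst ∘ z) := by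
  classical
  induction l generalizing z with
  | nil => rfl
  | cons v l ih =>
    rw [iteratedIntegral_cons, iteratedIntegral_cons, Kernel.parallelComp_apply]
    simp only [ih, Function.comp_update]
    exact measurePreserving_fst.lintegral_comp
      ((measurable_iteratedIntegral parent l).comp (measurable_update _))

theorem treeDensity_parallelComp {U : Type*} {F : SimpleGraph U} (L : AdmissibleLabeling F)
    (P : Measure X) (Q : Measure Y) [IsProbabilityMeasure Q] :
    treeDensity L (κ ∥ₖ η) (P.prod Q) = treeDensity L κ P :=
  congrArg ENNReal.toReal <|
    (lintegral_congr fun _ => iteratedIntegral_parallelComp κ η _ _ _).trans <|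
      measurePreserving_fst.lintegral_comp (measurable_rootedTreeDensity L)

end Products

section RandomWalk

variable {G : Type*} [AddGroup G] [MeasurableSpace G] [MeasurableAdd₂ G]

/-- The random walk on `G` whose independent steps, added on the right, have the law `ν`. -/
noncomputable def randomWalkKernel (ν : Measure G) : Kernel G G :=
  (Kernel.id ×ₖ Kernel.const G ν).map fun p => p.1 + p.2

instance (ν : Measure G) [IsProbabilityMeasure ν] : IsMarkovKernel (randomWalkKernel ν) :=
  Kernel.IsMarkovKernel.map _ measurable_add

variable (ν : Measure G) [SFinite ν]

theorem randomWalkKernel_apply (g : G) : randomWalkKernel ν g = ν.map (g + ·) := by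
  rw [randomWalkKernel, Kernel.map_apply _ measurable_add, Kernel.prod_apply, Kernel.id_apply,
    Kernel.const_apply, Measure.dirac_prod, Measure.map_map measurable_add measurable_prodMk_left]
  rfl

theorem randomWalkKernel_apply_apply (g : G) {s : Set G} (hs : MeasurableSet s) :
    randomWalkKernel ν g s = ν ((g + ·) ⁻¹' s) := by
  rw [randomWalkKernel_apply, Measure.map_apply (measurable_const_add g) hs]

theorem isReversible_randomWalkKernel [MeasurableNeg G] [ν.IsNegInvariant] (μ : Measure G)
    [SFinite μ] [μ.IsAddRightInvariant] : (randomWalkKernel ν).IsReversible μ := by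
  have setLIntegral_eq (A B : Set G) (hA : MeasurableSet A) (hB : MeasurableSet B) :
      ∫⁻ g in A, randomWalkKernel ν g B ∂μ =
        ∫⁻ s, ∫⁻ g, A.indicator 1 g * B.indicator 1 (g + s) ∂μ ∂ν := by
    rw [lintegral_lintegral_swap, ← lintegral_indicator hA]
    · refine lintegral_congr fun g => ?_
      by_cases hg : g ∈ A
      · simp only [Set.indicator_of_mem hg, Pi.one_apply, one_mul]
        exact (randomWalkKernel_apply_apply ν g hB).trans
          (lintegral_indicator_one (measurable_const_add g hB)).symm
      · simp [hg]
    · exact (((measurable_one.indicator hA).comp measurable_snd).mul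
        ((measurable_one.indicator hB).comp (measurable_snd.add measurable_fst))).aemeasurable
  intro A B hA hB
  calc ∫⁻ g in A, randomWalkKernel ν g B ∂μ
      = ∫⁻ s, ∫⁻ g, A.indicator 1 g * B.indicator 1 (g + s) ∂μ ∂ν := setLIntegral_eq A B hA hB
    _ = ∫⁻ s, ∫⁻ g, A.indicator 1 (g + -s) * B.indicator 1 g ∂μ ∂ν := by
      refine lintegral_congr fun s => ?_
      rw [← lintegral_add_right_eq_self _ (-s)]
      simp only [neg_add_cancel_right]
    _ = ∫⁻ s, ∫⁻ g, B.indicator 1 g * A.indicator 1 (g + s) ∂μ ∂ν := by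
      rw [← lintegral_neg_eq_self]
      simp only [neg_neg, mul_comm]
    _ = ∫⁻ g in B, randomWalkKernel ν g A ∂μ := (setLIntegral_eq B A hB hA).symm

variable [MeasurableSingletonClass G] [NullSingletonClass ν]

instance (g : G) : NullSingletonClass (randomWalkKernel ν g) where
  measure_singleton h := by
    rw [randomWalkKernel_apply_apply ν g (measurableSet_singleton h)]
    convert measure_singleton (μ := ν) (-g + h)
    ext; simp [eq_neg_add_iff_add_eq]

theorem ae_iterKernel_randomWalkKernel_ne (k : ℕ) (g h : G) :
    ∀ᵐ y ∂iterKernel (randomWalkKernel ν) (k + 1) g, y ≠ h := by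
  rw [iterKernel, ae_iff, Kernel.comp_apply' _ _ _ (by simp)]
  simp

/-- A walk that is not at `g` after `k + 1` steps is almost surely not in `g + S` after the next
one, whereas a single step leads from `g` to `g + S`. -/
theorem isAcyclicKernel_randomWalkKernel {S : Set G} (hS : MeasurableSet S) (hνS : ν Sᶜ = 0)
    (hν : ∀ w ≠ 0, ν ((w + ·) ⁻¹' S) = 0) (μ : Measure G) :
    IsAcyclicKernel (randomWalkKernel ν) μ := by
  refine .of_forall fun g k hk => ?_
  have measurableSet_translate : MeasurableSet ((-g + ·) ⁻¹' S) := measurable_const_add (-g) hS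
  obtain _ | _ | k := k
  · exact mutuallySingular_dirac g _
  · exact absurd rfl hk
  · refine ⟨(-g + ·) ⁻¹' S, measurableSet_translate, ?_, ?_⟩
    · rw [iterKernel, Kernel.comp_apply' _ _ _ measurableSet_translate]
      refine lintegral_eq_zero_of_ae_eq_zero ?_
      filter_upwards [ae_iterKernel_randomWalkKernel_ne ν k g g] with y hy
      rw [randomWalkKernel_apply_apply ν y measurableSet_translate, Set.preimage_preimage]
      simp only [← add_assoc]
      exact hν _ fun h => hy (neg_add_eq_zero.1 h).symm
    · rw [randomWalkKernel_apply_apply ν g measurableSet_translate.compl]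
      simpa [Set.preimage_preimage] using hνS

end RandomWalk

section Cuts

/-- The Dedekind cut of a real number, as an element of a compact group of exponent `2`. -/
noncomputable def cut (t : ℝ) : ℚ → ZMod 2 := fun q => if (q : ℝ) < t then 1 else 0

theorem measurable_cut : Measurable cut :=
  measurable_pi_lambda _ fun _ =>
    .ite (measurableSet_lt measurable_const measurable_id) measurable_const measurable_const

theorem exists_rat_cut_eq {t : ℝ} {S : Finset ℝ} (hS : t ∉ S) :
    ∃ q q' : ℚ, cut t q = 1 ∧ cut t q' = 0 ∧ ∀ u ∈ S, cut u q = cut u q' := by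
  obtain ⟨ε, hε, hball⟩ := Metric.isOpen_iff.1 S.finite_toSet.isClosed.isOpen_compl t (by simpa)
  obtain ⟨q, hq, hqt⟩ := exists_rat_btwn (sub_lt_self t hε)
  obtain ⟨q', htq', hq'⟩ := exists_rat_btwn (lt_add_of_pos_right t hε)
  refine ⟨q, q', if_pos hqt, if_neg htq'.not_gt, fun u hu => ?_⟩
  have dist_ge : u ∉ Metric.ball t ε := fun h => hball h (by simpa using hu)
  rw [Metric.mem_ball, Real.dist_eq, not_lt, le_abs] at dist_ge
  unfold cut
  obtain h | h := dist_ge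
  · rw [if_pos (by linarith), if_pos (by linarith)]
  · rw [if_neg (by linarith), if_neg (by linarith)]

theorem cut_injective : Function.Injective cut := by
  intro t s h
  by_contra hts
  obtain ⟨q, q', hq, hq', hs⟩ := exists_rat_cut_eq (S := {s}) (by simpa using hts)
  have := hs s (by simp)
  rw [← h, hq, hq'] at this
  exact one_ne_zero this

theorem measurableSet_range_cut : MeasurableSet (Set.range cut) :=
  (measurable_cut.measurableEmbedding cut_injective).measurableSet_range

/-- The cuts form a Sidon set: if `cut s₀ = w + cut t₀` and `cut s = w + cut t`, where `t` differs
from `s₀`, `t₀` and `s`, then these equations disagree at two rationals separated by `t` alone. -/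
theorem finite_preimage_add_cut {w : ℚ → ZMod 2} (hw : w ≠ 0) :
    ((fun t => w + cut t) ⁻¹' Set.range cut).Finite := by
  obtain h | ⟨t₀, s₀, h₀⟩ := ((fun t => w + cut t) ⁻¹' Set.range cut).eq_empty_or_nonempty
  · exact h ▸ Set.finite_empty
  refine (Set.toFinite {t₀, s₀}).subset ?_
  rintro t ⟨s, h⟩
  by_contra ht
  rw [Set.mem_insert_iff, Set.mem_singleton_iff, not_or] at ht
  have hts : t ≠ s := by
    rintro rfl
    exact hw (by simpa using h)
  obtain ⟨q, q', hq, hq', heq⟩ := exists_rat_cut_eq (t := t) (S := {t₀, s₀, s}) (by simp [ht, hts])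
  have w_eq : w q = w q' := by
    have : w q + cut t₀ q = w q' + cut t₀ q' := by
      simpa only [h₀, Pi.add_apply] using heq s₀ (by simp)
    rw [heq t₀ (by simp)] at this
    exact add_right_cancel this
  have : w q + cut t q = w q' + cut t q' := by
    simpa only [h, Pi.add_apply] using heq s (by simp)
  rw [hq, hq', w_eq] at this
  exact one_ne_zero (add_left_cancel this)

/-- The law of the cut at a uniform random point of `[0, 1]`. -/
noncomputable def cutLaw : Measure (ℚ → ZMod 2) :=
  (volume.restrict unitInterval).map cut

instance : IsProbabilityMeasure cutLaw :=
  have : IsProbabilityMeasure (volume.restrict unitInterval) := ⟨by simp [unitInterval]⟩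
  Measure.isProbabilityMeasure_map measurable_cut.aemeasurable

theorem cutLaw_eq_zero {s : Set (ℚ → ZMod 2)} (hs : MeasurableSet s)
    (h : (cut ⁻¹' s).Countable) : cutLaw s = 0 := by
  rw [cutLaw, Measure.map_apply measurable_cut hs]
  exact h.measure_zero _

instance : NullSingletonClass cutLaw :=
  ⟨fun x => cutLaw_eq_zero (measurableSet_singleton x)
    (Set.subsingleton_singleton.preimage cut_injective).countable⟩

instance : cutLaw.IsNegInvariant :=
  ⟨by
    have : (Neg.neg : (ℚ → ZMod 2) → ℚ → ZMod 2) = id := funext CharTwo.neg_eq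
    rw [Measure.neg_def, this, Measure.map_id]⟩

theorem isAcyclicKernel_randomWalkKernel_cutLaw (μ : Measure (ℚ → ZMod 2)) :
    IsAcyclicKernel (randomWalkKernel cutLaw) μ :=
  isAcyclicKernel_randomWalkKernel cutLaw measurableSet_range_cut
    (cutLaw_eq_zero measurableSet_range_cut.compl (by simp))
    (fun w hw => cutLaw_eq_zero (measurable_const_add w measurableSet_range_cut)
      (finite_preimage_add_cut hw).countable) μ

/-- The normalized Haar measure on the compact group of all maps `ℚ → ℤ/2`. -/
noncomputable def cutHaar : Measure (ℚ → ZMod 2) := Measure.addHaarMeasure ⊤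

instance : IsProbabilityMeasure cutHaar := ⟨Measure.addHaarMeasure_self⟩

instance : cutHaar.IsAddLeftInvariant :=
  inferInstanceAs (Measure.addHaarMeasure (G := ℚ → ZMod 2) ⊤).IsAddLeftInvariant

theorem exists_acyclic_reversible_isMarkovKernel :
    ∃ (Y : Type) (_ : MeasurableSpace Y) (Q : Measure Y) (η : Kernel Y Y),
      IsProbabilityMeasure Q ∧ IsMarkovKernel η ∧ η.IsReversible Q ∧ IsAcyclicKernel η Q :=
  ⟨ℚ → ZMod 2, inferInstance, cutHaar, randomWalkKernel cutLaw, inferInstance, inferInstance,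
    isReversible_randomWalkKernel cutLaw cutHaar, isAcyclicKernel_randomWalkKernel_cutLaw cutHaar⟩

end Cuts

section Isomorphisms

variable {U V W : Type*} {G : SimpleGraph V} {H : SimpleGraph W} {d : ℝ}

theorem IsAdmissiblePair.of_iso (h : IsAdmissiblePair H d) (e : G ≃g H) : IsAdmissiblePair G d :=
  ⟨h.1, fun v => Nat.card_congr (e.mapNeighborSet v) ▸ h.2 (e v)⟩

theorem homDensity_congr_iso (F : SimpleGraph U) (e : G ≃g H) (d : ℝ) :
    homDensity F G d = homDensity F H d := by
  let homEquiv : (F →g G) ≃ (F →g H) :=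
    ⟨e.toHom.comp, e.symm.toHom.comp, fun f => by ext; simp, fun f => by ext; simp⟩
  rw [homDensity, homDensity, Nat.card_congr homEquiv, Nat.card_congr e.toEquiv]

end Isomorphisms

end GraphLimit

open GraphLimit in
theorem mainTheorem8_general.{u} {ι : Type u} (𝒰 : Ultrafilter ι) [CountablyIncomplete 𝒰]
    {V : ι → Type*} [∀ i, Finite (V i)] [∀ i, Nonempty (V i)] (G : ∀ i, SimpleGraph (V i))
    (d : ι → ℝ) (hadm : ∀ i, IsAdmissiblePair (G i) (d i)) :
    ∃ (X : Type u) (_ : MeasurableSpace X) (P : Measure X) (deg : Kernel X X),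
      IsProbabilityMeasure P ∧ IsSubMarkov deg ∧ deg.IsReversible P ∧ IsAcyclicKernel deg P ∧
      ∀ (U : Type*) [Finite U] (F : SimpleGraph U), F.IsTree → ∀ L : AdmissibleLabeling F,
        Tendsto (fun i => homDensity F (G i) (d i)) 𝒰 (𝓝 (treeDensity L deg P)) := by
  let W (i : ι) : Type := Fin (Nat.card (V i))
  let _ (i : ι) : MeasurableSpace (W i) := ⊤
  have (i : ι) : DiscreteMeasurableSpace (W i) := ⟨fun _ => trivial⟩
  let e (i : ι) : W i ≃ V i := (Finite.equivFin (V i)).symm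
  have (i : ι) : Nonempty (W i) := (e i).nonempty
  let H (i : ι) : SimpleGraph (W i) := (G i).comap (e i)
  let iso (i : ι) : H i ≃g G i := .comap (e i) (G i)
  have hκ (i : ι) : IsSubMarkov (graphKernel (H i) (d i)) :=
    isSubMarkov_graphKernel ((hadm i).of_iso (iso i))
  obtain ⟨Y, _, Q, η, _, _, reversible_η, acyclic_η⟩ := exists_acyclic_reversible_isMarkovKernel
  have subMarkov := isSubMarkov_loebKernel (𝒰 := 𝒰) hκ
  have := subMarkov.isFiniteKernel
  let P := loebMeasure 𝒰 fun i => uniformOn (Set.univ : Set (W i))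
  refine ⟨Ultraproduct 𝒰 W × Y, inferInstance, P.prod Q, loebKernel 𝒰 hκ ∥ₖ η, inferInstance,
    subMarkov.parallelComp fun _ => prob_le_one, isReversible_parallelComp
      (isReversible_loebKernel hκ fun i => isReversible_graphKernel (H i) (d i)) reversible_η,
    acyclic_η.parallelComp _ _, fun U _ F hF L => ?_⟩
  have d_nonneg (i : ι) : 0 ≤ d i := zero_le_one.trans (hadm i).1
  rw [treeDensity_parallelComp]
  simpa only [treeDensity_graphKernel hF L _ (d_nonneg _), homDensity_congr_iso F (iso _)] using
    tendsto_treeDensity_loebKernel L hκ fun i => uniformOn (Set.univ : Set (W i))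

theorem mainTheorem8 {V : ℕ → Type*} [∀ n, Finite (V n)] [∀ n, Nonempty (V n)]
    (G : ∀ n, SimpleGraph (V n)) (d : ℕ → ℝ)
    (hadm : ∀ n, GraphLimit.IsAdmissiblePair (G n) (d n))
    (hconv : ∀ (U : Type) [Finite U] (F : SimpleGraph U), F.IsTree →
      ∃ t : ℝ, Tendsto (fun n => GraphLimit.homDensity F (G n) (d n)) atTop (𝓝 t)) :
    ∃ (X : Type) (_ : MeasurableSpace X) (P : Measure X) (deg : Kernel X X),
      IsProbabilityMeasure P ∧
      GraphLimit.IsSubMarkov deg ∧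
      deg.IsReversible P ∧
      GraphLimit.IsAcyclicKernel deg P ∧
      ∀ (U : Type) [Finite U] (F : SimpleGraph U), F.IsTree →
        ∀ L : GraphLimit.AdmissibleLabeling F,
          Tendsto (fun n => GraphLimit.homDensity F (G n) (d n)) atTop
            (𝓝 (GraphLimit.treeDensity L deg P)) := by
  obtain ⟨X, _, P, deg, prob, subMarkov, reversible, acyclic, hlim⟩ :=
    mainTheorem8_general (hyperfilter ℕ) G d hadm
  refine ⟨X, _, P, deg, prob, subMarkov, reversible, acyclic, fun U _ F hF L => ?_⟩
  obtain ⟨t, ht⟩ := hconv U F hF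
  rwa [← tendsto_nhds_unique (ht.mono_left Nat.hyperfilter_le_atTop) (hlim U F hF L)]
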